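/- Let $n\ge 0$ be an integer, let $Q\in\mathbb R^{n\times n}$, $z\in\mathbb R^n$, $\Phi_1,\dots,\Phi_n\in\mathbb R^n$, and let $\lambda_1,\lambda_2>0$. Write $\langle A,B\rangle=\operatorname{tr}(A^\top B)$, let $\Phi(X)=(\langle X,\Phi_i\Phi_i^\top\rangle)_{i=1}^n$ for $X\in\mathbb R^{n\times n}$ and $\Phi^\star(\gamma)=\sum_{i=1}^n\gamma_i\Phi_i\Phi_i^\top$ for $\gamma\in\mathbb R^n$. Let $\mathcal S^n_+$ be the cone of symmetric positive semidefinite real $n\times n$ matrices, and let $\operatorname{proj}_{\mathcal S^n_+}(Z)$ be the point of $\mathcal S^n_+$ nearest to $Z\in\mathbb R^{n\times n}$ in the Frobenius norm. Equip $\mathbb R^n\times\mathbb R^{n\times n}$ with the norm $\|(\gamma,X)\|=\|\gamma\|_2+\|X\|_F$. Then the residual map $R:\mathbb R^n\times\mathbb R^{n\times n}\to\mathbb R^n\times\mathbb R^{n\times n}$, $$R(\gamma,X)=\begin{pmatrix}\tfrac1{2\lambda_2}Q\gamma-\tfrac1{2\lambda_2}z-\Phi(X)\\[2pt] X-\operatorname{proj}_{\mathcal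 S^n_+}\bigl(X-(\Phi^\star(\gamma)+\lambda_1 I)\bigr)\end{pmatrix},$$ is strongly semismooth. That is, $R$ is Lipschitz, and at every point $w$: (i) $R$ is directionally differentiable at $w$: for every direction $h$ the limit $\lim_{t\downarrow0}\bigl(R(w+th)-R(w)\bigr)/t$ exists; (ii) there are $C\ge 0$ and $\delta>0$ such that for all $\Delta w$ with $\|\Delta w\|<\delta$ and all $\mathcal J\in\partial R(w+\Delta w)$, $$\|R(w+\Delta w)-R(w)-\mathcal J[\Delta w]\|\le C\|\Delta w\|^2 .$$ Here $\partial R(w)$ is the generalized Jacobian, i.e. the convex hull of the set $\partial_B R(w)$ of all limits $\lim_k \nabla R(w^k)$ along sequences $w^k\to w$ of points at which $R$ is differentiable. -/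

import Mathlib

open Filter Topology
open scoped Matrix Matrix.Norms.Frobenius

noncomputable section

section Semismooth

variable {E F : Type*} [NormedAddCommGroup E] [NormedSpace ℝ E]
  [NormedAddCommGroup F] [NormedSpace ℝ F]

/-- The B-subdifferential of `f` at `w`: all limits of derivatives `∇f(wₖ)` along sequences
`wₖ → w` of points of differentiability. -/
def bSubdifferential (f : E → F) (w : E) : Set (E →L[ℝ] F) :=
  {J | ∃ u : ℕ → E, (∀ k, DifferentiableAt ℝ f (u k)) ∧ Tendsto u atTop (𝓝 w) ∧
    Tendsto (fun k => fderiv ℝ f (u k)) atTop (𝓝 J)}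

/-- Clarke's generalized Jacobian: the convex hull of the B-subdifferential. -/
def generalizedJacobian (f : E → F) (w : E) : Set (E →L[ℝ] F) :=
  convexHull ℝ (bSubdifferential f w)

/-- The one-sided directional derivative of `f` at `w` exists in every direction. -/
def DirectionallyDifferentiableAt (f : E → F) (w : E) : Prop :=
  ∀ h : E, ∃ d : F, Tendsto (fun t : ℝ => t⁻¹ • (f (w + t • h) - f w)) (𝓝[>] 0) (𝓝 d)

/-- Strong semismoothness at `w` (of a Lipschitz map): directional differentiability, and a
quadratic first-order error for all small increments `Δ`, uniformly over all elements of the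
generalized Jacobian at `w + Δ`. -/
def StronglySemismoothAt (f : E → F) (w : E) : Prop :=
  DirectionallyDifferentiableAt f w ∧
    ∃ C : ℝ, ∀ᶠ Δ in 𝓝 (0 : E), ∀ J ∈ generalizedJacobian f (w + Δ),
      ‖f (w + Δ) - f w - J Δ‖ ≤ C * ‖Δ‖ ^ 2

/-- A strongly semismooth map: a Lipschitz map that is strongly semismooth at every point. -/
def StronglySemismooth (f : E → F) : Prop :=
  (∃ L : NNReal, LipschitzWith L f) ∧ ∀ w, StronglySemismoothAt f w

end Semismooth

/-- The cone of symmetric positive semidefinite real `n × n` matrices. -/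
def psdCone (n : ℕ) : Set (Matrix (Fin n) (Fin n) ℝ) := {X | X.PosSemidef}

theorem isClosed_psdCone (n : ℕ) : IsClosed (psdCone n) := by
  have h : psdCone n = {X | Xᴴ = X} ∩ ⋂ v : Fin n → ℝ, {X | 0 ≤ star v ⬝ᵥ (X *ᵥ v)} := by
    ext X
    simp [psdCone, Matrix.posSemidef_iff_dotProduct_mulVec, Matrix.IsHermitian]
  rw [h]
  refine (isClosed_eq (by fun_prop) (by fun_prop)).inter (isClosed_iInter fun v => ?_)
  exact isClosed_le (by fun_prop) (by fun_prop)

theorem exists_nearest_psdCone {n : ℕ} (Z : Matrix (Fin n) (Fin n) ℝ) :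
    ∃ P ∈ psdCone n, ∀ Y ∈ psdCone n, ‖Z - P‖ ≤ ‖Z - Y‖ := by
  have : ProperSpace (Matrix (Fin n) (Fin n) ℝ) := FiniteDimensional.proper ℝ _
  obtain ⟨P, hP, h⟩ := (isClosed_psdCone n).exists_infDist_eq_dist
    ⟨0, Matrix.PosSemidef.zero⟩ Z
  refine ⟨P, hP, fun Y hY => ?_⟩
  rw [← dist_eq_norm, ← dist_eq_norm, ← h]
  exact Metric.infDist_le_dist_of_mem hY

/-- The projection of an arbitrary square matrix onto the positive semidefinite cone: its
nearest point in the cone for the Frobenius norm (unique because the cone is convex). -/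
def projPSD {n : ℕ} (Z : Matrix (Fin n) (Fin n) ℝ) : Matrix (Fin n) (Fin n) ℝ :=
  (exists_nearest_psdCone Z).choose

/-- Vector-matrix pairs `w = (γ, X)` with `‖w‖ = ‖γ‖₂ + ‖X‖_F`. -/
abbrev PairSpace (n : ℕ) : Type :=
  WithLp 1 (EuclideanSpace ℝ (Fin n) × Matrix (Fin n) (Fin n) ℝ)

/-- `Φ(X) = (⟨X, Φᵢ Φᵢᵀ⟩)ᵢ` with `⟨A, B⟩ = tr(Aᵀ B)`, for vectors `Φ₁, …, Φₙ`. -/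
def opPhi {n : ℕ} (Φ : Fin n → Fin n → ℝ) (X : Matrix (Fin n) (Fin n) ℝ) : Fin n → ℝ :=
  fun i => (Xᵀ * Matrix.vecMulVec (Φ i) (Φ i)).trace

/-- `Φ*(γ) = ∑ᵢ γᵢ Φᵢ Φᵢᵀ`. -/
def opPhiAdj {n : ℕ} (Φ : Fin n → Fin n → ℝ) (γ : Fin n → ℝ) : Matrix (Fin n) (Fin n) ℝ :=
  ∑ i, γ i • Matrix.vecMulVec (Φ i) (Φ i)

/-- The residual map `R(γ, X) = ((1/2λ₂) Q γ - (1/2λ₂) z - Φ(X), X - proj(X - (Φ*(γ) + λ₁ I)))`. -/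
def residualMap {n : ℕ} (Q : Matrix (Fin n) (Fin n) ℝ) (z : Fin n → ℝ)
    (Φ : Fin n → Fin n → ℝ) (lam₁ lam₂ : ℝ) (w : PairSpace n) : PairSpace n :=
  WithLp.toLp 1
    (WithLp.toLp 2
      ((1 / (2 * lam₂)) • (Q *ᵥ w.fst.ofLp) - (1 / (2 * lam₂)) • z - opPhi Φ w.snd),
     w.snd - projPSD (w.snd - (opPhiAdj Φ w.fst.ofLp + lam₁ • (1 : Matrix (Fin n) (Fin n) ℝ))))

/-!
The residual map is an affine map plus a linear image of the projection onto the positive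
semidefinite cone of an affine map, and the projection of `Z` is the positive part of the symmetric
part of `Z`. Write `x⁺ = x / 2 + |x| / 2`. If all nonzero eigenvalues of the symmetric part of `Z`
exceed `c` in absolute value, the corner of `|x| / 2` may be moved from `0` to the points `c / 2`
and `c`, or to `-c / 2` and `-c`: these are not eigenvalues, and `|S - r|` is a smooth function of
the symmetric matrix `S` where `S - r` is invertible, by the inverse function theorem for `X ↦ X²`
at a positive definite matrix. The two modified functions `a` and `b` agree on the spectrum, and
`|x| / 2` is their maximum `a + (b - a)⁺`. So, near `Z`, the projection is a `C²` map plus the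
projection itself applied to a `C²` map vanishing at `Z`.

Let `f = φ + P ∘ ψ` with `φ`, `ψ` of class `C²`, `ψ w = 0`, and `P` Lipschitz and positively
homogeneous. The Taylor expansions of `φ` and `ψ` about the moving point `u` have an error quadratic
in `u - w`, and by homogeneity `P` transfers that of `ψ` to `P ∘ ψ` with only its Lipschitz constant
lost. This bounds `f u - f w - f' u (u - w)` wherever `f` is differentiable, and the bound passes to
limits and convex combinations of derivatives.
-/

section DecomposableMaps

variable {E F G H V W : Type*} [NormedAddCommGroup E] [NormedSpace ℝ E]
  [NormedAddCommGroup F] [NormedSpace ℝ F] [NormedAddCommGroup G] [NormedSpace ℝ G]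
  [NormedAddCommGroup H] [NormedSpace ℝ H]
  [AddCommMonoid V] [Module ℝ V] [AddCommMonoid W] [Module ℝ W]

/-- Positive homogeneity of degree one. The factor `0` is allowed, so that `P 0 = 0`. -/
def PositivelyHomogeneous (P : V → W) : Prop :=
  ∀ ⦃t : ℝ⦄, 0 ≤ t → ∀ x, P (t • x) = t • P x

/-- Decomposability of `f` at `w`: near `w`, `f` is a `C²` map plus the composition of `P` with a
`C²` map vanishing at `w`. This is Shapiro's notion of a decomposable map; it is only of interest
when the outer map `P` is positively homogeneous. -/
def DecomposableAt (P : G → F) (f : E → F) (w : E) : Prop :=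
  ∃ (φ : E → F) (ψ : E → G), ContDiffAt ℝ 2 φ w ∧ ContDiffAt ℝ 2 ψ w ∧ ψ w = 0 ∧
    f =ᶠ[𝓝 w] fun u => φ u + P (ψ u)

theorem PositivelyHomogeneous.map_zero {P : V → W} (hP : PositivelyHomogeneous P) : P 0 = 0 := by
  simpa only [zero_smul] using hP le_rfl 0

theorem DecomposableAt.comp {P : G → F} {f : E → F} {g : H → E} {w : H}
    (hf : DecomposableAt P f (g w)) (hg : ContDiffAt ℝ 2 g w) :
    DecomposableAt P (fun u => f (g u)) w := by
  obtain ⟨φ, ψ, hφ, hψ, hψ₀, hf⟩ := hf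
  exact ⟨fun u => φ (g u), fun u => ψ (g u), ContDiffAt.comp w hφ hg, ContDiffAt.comp w hψ hg, hψ₀,
    hg.continuousAt.eventually hf⟩

theorem DecomposableAt.clm_comp {P : G → F} {f : E → F} {w : E} (L : F →L[ℝ] H)
    (hf : DecomposableAt P f w) : DecomposableAt (fun x => L (P x)) (fun u => L (f u)) w := by
  obtain ⟨φ, ψ, hφ, hψ, hψ₀, hf⟩ := hf
  refine ⟨fun u => L (φ u), ψ, ContDiffAt.comp w L.contDiff.contDiffAt hφ, hψ, hψ₀, ?_⟩
  filter_upwards [hf] with u hu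
  rw [hu, map_add]

theorem DecomposableAt.contDiffAt_add {P : G → F} {f θ : E → F} {w : E}
    (hf : DecomposableAt P f w) (hθ : ContDiffAt ℝ 2 θ w) :
    DecomposableAt P (fun u => θ u + f u) w := by
  obtain ⟨φ, ψ, hφ, hψ, hψ₀, hf⟩ := hf
  refine ⟨fun u => θ u + φ u, ψ, hθ.add hφ, hψ, hψ₀, ?_⟩
  filter_upwards [hf] with u hu
  rw [hu, add_assoc]

theorem eventually_differentiableAt_of_contDiffAt {f : E → F} {w : E} (hf : ContDiffAt ℝ 2 f w) :
    ∀ᶠ u in 𝓝 w, DifferentiableAt ℝ f u :=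
  (hf.eventually (by simp)).mono fun _ hu => hu.differentiableAt two_ne_zero

theorem DecomposableAt.eventually_continuousAt {P : G → F} {f : E → F} {w : E} (hP : Continuous P)
    (hf : DecomposableAt P f w) : ∀ᶠ u in 𝓝 w, ContinuousAt f u := by
  obtain ⟨φ, ψ, hφ, hψ, -, hf⟩ := hf
  filter_upwards [eventually_differentiableAt_of_contDiffAt hφ,
    eventually_differentiableAt_of_contDiffAt hψ, hf.eventuallyEq_nhds] with u hφu hψu hfu
  exact (hφu.continuousAt.add (hP.continuousAt.comp hψu.continuousAt)).congr hfu.symm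

theorem DirectionallyDifferentiableAt.congr_of_eventuallyEq {f g : E → F} {w : E}
    (hg : DirectionallyDifferentiableAt g w) (h : f =ᶠ[𝓝 w] g) :
    DirectionallyDifferentiableAt f w := by
  intro v
  obtain ⟨d, hd⟩ := hg v
  have hline : Tendsto (fun t : ℝ => w + t • v) (𝓝[>] 0) (𝓝 w) := by
    have : Continuous fun t : ℝ => w + t • v := by fun_prop
    simpa using (this.tendsto 0).mono_left nhdsWithin_le_nhds
  refine ⟨d, hd.congr' ?_⟩
  filter_upwards [hline.eventually h] with t ht
  rw [ht, h.self_of_nhds]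

theorem DirectionallyDifferentiableAt.add {f g : E → F} {w : E}
    (hf : DirectionallyDifferentiableAt f w) (hg : DirectionallyDifferentiableAt g w) :
    DirectionallyDifferentiableAt (fun u => f u + g u) w := by
  intro v
  obtain ⟨a, ha⟩ := hf v
  obtain ⟨b, hb⟩ := hg v
  refine ⟨a + b, (ha.add hb).congr fun t => ?_⟩
  rw [← smul_add, add_sub_add_comm]

theorem directionallyDifferentiableAt_of_differentiableAt {f : E → F} {w : E}
    (hf : DifferentiableAt ℝ f w) : DirectionallyDifferentiableAt f w := fun v =>
  ⟨_, (hf.hasFDerivAt.hasLineDerivAt v).tendsto_slope_zero_right⟩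

theorem PositivelyHomogeneous.directionallyDifferentiableAt_comp {P : G → F}
    (hom : PositivelyHomogeneous P) (hP : Continuous P) {ψ : E → G} {w : E}
    (hψ : DifferentiableAt ℝ ψ w) (hψ₀ : ψ w = 0) :
    DirectionallyDifferentiableAt (fun u => P (ψ u)) w := by
  intro v
  obtain ⟨d, hd⟩ := directionallyDifferentiableAt_of_differentiableAt hψ v
  refine ⟨P d, ((hP.tendsto d).comp hd).congr' ?_⟩
  filter_upwards [self_mem_nhdsWithin] with t ht
  simp only [Function.comp_apply, hψ₀, sub_zero, hom.map_zero,
    hom (inv_nonneg.2 (Set.mem_Ioi.1 ht).le)]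

theorem DecomposableAt.directionallyDifferentiableAt {P : G → F} {f : E → F} {w : E}
    (hom : PositivelyHomogeneous P) (hP : Continuous P) (hf : DecomposableAt P f w) :
    DirectionallyDifferentiableAt f w := by
  obtain ⟨φ, ψ, hφ, hψ, hψ₀, hf⟩ := hf
  have hφ' := directionallyDifferentiableAt_of_differentiableAt (hφ.differentiableAt two_ne_zero)
  have hPψ := hom.directionallyDifferentiableAt_comp hP (hψ.differentiableAt two_ne_zero) hψ₀
  exact (hφ'.add hPψ).congr_of_eventuallyEq hf

theorem exists_norm_sub_sub_fderiv_le_of_contDiffAt {f : E → F} {w : E}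
    (hf : ContDiffAt ℝ 2 f w) :
    ∃ C : ℝ, ∀ᶠ u in 𝓝 w, ‖f u - f w - fderiv ℝ f u (u - w)‖ ≤ C * ‖u - w‖ ^ 2 := by
  obtain ⟨K, t, ht, hK⟩ := (hf.fderiv_right (m := 1) (by norm_num)).exists_lipschitzOnWith
  obtain ⟨r, hr, hball⟩ := Metric.mem_nhds_iff.1
    (inter_mem ht (eventually_differentiableAt_of_contDiffAt hf))
  refine ⟨K, ?_⟩
  filter_upwards [Metric.ball_mem_nhds w hr] with u hu
  have hseg : segment ℝ w u ⊆ Metric.ball w r :=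
    (convex_ball w r).segment_subset (Metric.mem_ball_self hr) hu
  have hderiv : ∀ x ∈ segment ℝ w u, ‖fderiv ℝ f x - fderiv ℝ f u‖ ≤ K * ‖u - w‖ := by
    intro x hx
    have hxu : ‖x - u‖ ≤ ‖u - w‖ := by
      rw [norm_sub_rev u w]
      exact norm_sub_le_of_mem_segment (segment_symm ℝ w u ▸ hx)
    exact (hK.norm_sub_le (hball (hseg hx)).1 (hball hu).1).trans (by gcongr)
  calc ‖f u - f w - fderiv ℝ f u (u - w)‖ ≤ K * ‖u - w‖ * ‖u - w‖ :=
        (convex_segment w u).norm_image_sub_le_of_norm_hasFDerivWithin_le'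
          (fun x hx => (hball (hseg hx)).2.hasFDerivAt.hasFDerivWithinAt) hderiv
          (left_mem_segment ℝ w u) (right_mem_segment ℝ w u)
    _ = K * ‖u - w‖ ^ 2 := by ring

/-- Homogeneity turns `P (ψ u)` minus the difference quotient of `P ∘ ψ` along `Δ` into a difference
of two values of `P` over `t`, to which the Lipschitz bound applies. -/
theorem PositivelyHomogeneous.norm_comp_sub_fderiv_le {P : G → F} {K : NNReal}
    (hom : PositivelyHomogeneous P) (hP : LipschitzWith K P) {ψ : E → G} {u : E}
    (hψ : DifferentiableAt ℝ ψ u) (hPψ : DifferentiableAt ℝ (fun x => P (ψ x)) u) (Δ : E) :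
    ‖P (ψ u) - fderiv ℝ (fun x => P (ψ x)) u Δ‖ ≤ K * ‖ψ u - fderiv ℝ ψ u Δ‖ := by
  have hlim₁ := (hPψ.hasFDerivAt.hasLineDerivAt Δ).tendsto_slope_zero_right
  have hlim₂ := (hψ.hasFDerivAt.hasLineDerivAt Δ).tendsto_slope_zero_right
  refine le_of_tendsto_of_tendsto (tendsto_const_nhds.sub hlim₁).norm
    ((tendsto_const_nhds.sub hlim₂).norm.const_mul (K : ℝ)) ?_
  filter_upwards [self_mem_nhdsWithin] with t (ht : 0 < t)
  have hquot₁ : P (ψ u) - t⁻¹ • (P (ψ (u + t • Δ)) - P (ψ u)) =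
      t⁻¹ • (P ((1 + t) • ψ u) - P (ψ (u + t • Δ))) := by
    rw [hom (by positivity)]
    match_scalars <;> field
  have hquot₂ : ψ u - t⁻¹ • (ψ (u + t • Δ) - ψ u) = t⁻¹ • ((1 + t) • ψ u - ψ (u + t • Δ)) := by
    match_scalars <;> field
  rw [hquot₁, hquot₂, norm_smul, norm_smul, mul_left_comm]
  gcongr
  exact hP.norm_sub_le _ _

theorem PositivelyHomogeneous.norm_sub_sub_fderiv_le {P : G → F} {K : NNReal}
    (hom : PositivelyHomogeneous P) (hP : LipschitzWith K P) {f φ : E → F} {ψ : E → G} {u : E}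
    (hφ : DifferentiableAt ℝ φ u) (hψ : DifferentiableAt ℝ ψ u) (hfu : DifferentiableAt ℝ f u)
    (hf : f =ᶠ[𝓝 u] fun x => φ x + P (ψ x)) (a : F) (Δ : E) :
    ‖f u - a - fderiv ℝ f u Δ‖ ≤
      ‖φ u - a - fderiv ℝ φ u Δ‖ + K * ‖ψ u - fderiv ℝ ψ u Δ‖ := by
  have hPψ : DifferentiableAt ℝ (fun x => P (ψ x)) u := by
    refine (hfu.sub hφ).congr_of_eventuallyEq ?_
    filter_upwards [hf] with x hx
    rw [Pi.sub_apply, hx, add_sub_cancel_left]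
  have hderiv : fderiv ℝ f u Δ = fderiv ℝ φ u Δ + fderiv ℝ (fun x => P (ψ x)) u Δ := by
    rw [hf.fderiv_eq, fderiv_fun_add hφ hPψ, _root_.add_apply]
  have hval : f u = φ u + P (ψ u) := hf.self_of_nhds
  calc ‖f u - a - fderiv ℝ f u Δ‖
      = ‖(φ u - a - fderiv ℝ φ u Δ) + (P (ψ u) - fderiv ℝ (fun x => P (ψ x)) u Δ)‖ := by
        rw [hval, hderiv]
        congr 1
        abel
    _ ≤ ‖φ u - a - fderiv ℝ φ u Δ‖ + ‖P (ψ u) - fderiv ℝ (fun x => P (ψ x)) u Δ‖ :=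
        norm_add_le _ _
    _ ≤ ‖φ u - a - fderiv ℝ φ u Δ‖ + K * ‖ψ u - fderiv ℝ ψ u Δ‖ := by
        gcongr
        exact hom.norm_comp_sub_fderiv_le hP hψ hPψ Δ

theorem DecomposableAt.exists_norm_sub_sub_fderiv_le {P : G → F} {K : NNReal} {f : E → F} {w : E}
    (hom : PositivelyHomogeneous P) (hP : LipschitzWith K P) (hf : DecomposableAt P f w) :
    ∃ C : ℝ, ∀ᶠ u in 𝓝 w, DifferentiableAt ℝ f u →
      ‖f u - f w - fderiv ℝ f u (u - w)‖ ≤ C * ‖u - w‖ ^ 2 := by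
  obtain ⟨φ, ψ, hφ, hψ, hψ₀, hf⟩ := hf
  obtain ⟨C₁, hC₁⟩ := exists_norm_sub_sub_fderiv_le_of_contDiffAt hφ
  obtain ⟨C₂, hC₂⟩ := exists_norm_sub_sub_fderiv_le_of_contDiffAt hψ
  have hfw : f w = φ w := by simpa only [hψ₀, hom.map_zero, add_zero] using hf.self_of_nhds
  refine ⟨C₁ + K * C₂, ?_⟩
  filter_upwards [hC₁, hC₂, eventually_differentiableAt_of_contDiffAt hφ,
    eventually_differentiableAt_of_contDiffAt hψ, hf.eventuallyEq_nhds] with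
    u hu₁ hu₂ hφu hψu hfu hd
  rw [hψ₀, sub_zero] at hu₂
  calc ‖f u - f w - fderiv ℝ f u (u - w)‖
      ≤ ‖φ u - φ w - fderiv ℝ φ u (u - w)‖ + K * ‖ψ u - fderiv ℝ ψ u (u - w)‖ :=
        hfw ▸ hom.norm_sub_sub_fderiv_le hP hφu hψu hd hfu _ _
    _ ≤ C₁ * ‖u - w‖ ^ 2 + K * (C₂ * ‖u - w‖ ^ 2) := by gcongr
    _ = (C₁ + K * C₂) * ‖u - w‖ ^ 2 := by ring

theorem norm_sub_sub_apply_le_of_mem_bSubdifferential {f : E → F} {v w : E} {C : ℝ}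
    (hf : ContinuousAt f v) (hC : ∀ᶠ u in 𝓝 v, DifferentiableAt ℝ f u →
      ‖f u - f w - fderiv ℝ f u (u - w)‖ ≤ C * ‖u - w‖ ^ 2)
    {J : E →L[ℝ] F} (hJ : J ∈ bSubdifferential f v) :
    ‖f v - f w - J (v - w)‖ ≤ C * ‖v - w‖ ^ 2 := by
  obtain ⟨u, hdiff, hu, hJ⟩ := hJ
  have hsub : Tendsto (fun k => u k - w) atTop (𝓝 (v - w)) := hu.sub_const w
  have hval : Tendsto (fun k => f (u k) - f w) atTop (𝓝 (f v - f w)) :=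
    (hf.tendsto.comp hu).sub_const (f w)
  have happ : Tendsto (fun k => fderiv ℝ f (u k) (u k - w)) atTop (𝓝 (J (v - w))) :=
    (isBoundedBilinearMap_apply.continuous.tendsto (J, v - w)).comp (hJ.prodMk_nhds hsub)
  refine le_of_tendsto_of_tendsto (hval.sub happ).norm ((hsub.norm.pow 2).const_mul C) ?_
  filter_upwards [hu.eventually hC] with k hk using hk (hdiff k)

theorem norm_sub_sub_apply_le_of_mem_generalizedJacobian {f : E → F} {v w : E} {C : ℝ}
    (hf : ContinuousAt f v) (hC : ∀ᶠ u in 𝓝 v, DifferentiableAt ℝ f u →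
      ‖f u - f w - fderiv ℝ f u (u - w)‖ ≤ C * ‖u - w‖ ^ 2)
    {J : E →L[ℝ] F} (hJ : J ∈ generalizedJacobian f v) :
    ‖f v - f w - J (v - w)‖ ≤ C * ‖v - w‖ ^ 2 := by
  have hconv : Convex ℝ {J : E →L[ℝ] F | J (v - w) ∈
      Metric.closedBall (f v - f w) (C * ‖v - w‖ ^ 2)} :=
    (convex_closedBall _ _).linear_preimage (ContinuousLinearMap.apply ℝ F (v - w)).toLinearMap
  have hmem := convexHull_min (fun J hJ => ?_) hconv hJ
  · rwa [Set.mem_ofPred_eq, mem_closedBall_iff_norm'] at hmem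
  · rw [Set.mem_ofPred_eq, mem_closedBall_iff_norm']
    exact norm_sub_sub_apply_le_of_mem_bSubdifferential hf hC hJ

theorem DecomposableAt.stronglySemismoothAt {P : G → F} {K : NNReal} {f : E → F} {w : E}
    (hom : PositivelyHomogeneous P) (hP : LipschitzWith K P) (hf : DecomposableAt P f w) :
    StronglySemismoothAt f w := by
  obtain ⟨C, hC⟩ := hf.exists_norm_sub_sub_fderiv_le hom hP
  refine ⟨hf.directionallyDifferentiableAt hom hP.continuous, C, ?_⟩
  have hshift : Tendsto (fun Δ : E => w + Δ) (𝓝 0) (𝓝 w) := by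
    simpa only [add_zero] using (continuous_const_add w).tendsto (0 : E)
  filter_upwards [hshift.eventually hC.eventually_nhds,
    hshift.eventually (hf.eventually_continuousAt hP.continuous)] with Δ hCΔ hcont J hJ
  simpa only [add_sub_cancel_left] using
    norm_sub_sub_apply_le_of_mem_generalizedJacobian hcont hCΔ hJ

end DecomposableMaps

section NearestPoint

variable {E : Type*} [NormedAddCommGroup E] [InnerProductSpace ℝ E]

open scoped RealInnerProductSpace

theorem eq_of_norm_sub_le_of_inner_nonneg {x p q : E} (hle : ‖x - p‖ ≤ ‖x - q‖)
    (hinner : 0 ≤ ⟪x - q, q - p⟫) : p = q := by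
  have hpyth : ‖x - p‖ ^ 2 = ‖x - q‖ ^ 2 + 2 * ⟪x - q, q - p⟫ + ‖q - p‖ ^ 2 := by
    rw [← norm_add_sq_real, sub_add_sub_cancel]
  have hdist : ‖q - p‖ ^ 2 ≤ 0 := by nlinarith [norm_nonneg (x - p)]
  rw [eq_comm, ← sub_eq_zero, ← norm_eq_zero, ← sq_eq_zero_iff]
  exact hdist.antisymm (sq_nonneg _)

theorem norm_sub_le_of_inner_nonneg {x y p q : E} (hp : 0 ≤ ⟪x - p, p - q⟫)
    (hq : 0 ≤ ⟪y - q, q - p⟫) : ‖p - q‖ ≤ ‖x - y‖ := by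
  have hmono : ‖p - q‖ ^ 2 ≤ ⟪x - y, p - q⟫ := by
    have hsplit : ⟪x - y, p - q⟫ = ⟪x - p, p - q⟫ + ⟪y - q, q - p⟫ + ⟪p - q, p - q⟫ := by
      simp only [inner_sub_left, inner_sub_right]
      ring
    rw [hsplit, real_inner_self_eq_norm_sq]
    linarith
  have hle : ‖p - q‖ * ‖p - q‖ ≤ ‖x - y‖ * ‖p - q‖ := by
    rw [← sq]
    exact hmono.trans (real_inner_le_norm _ _)
  rcases (norm_nonneg (p - q)).eq_or_lt' with hzero | hpos
  · exact hzero ▸ norm_nonneg _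
  · exact le_of_mul_le_mul_right hle hpos

end NearestPoint

section SymmetricPart

variable {m : Type*}

/-- The symmetric part of a real square matrix, as a continuous linear map. -/
def symPart : Matrix m m ℝ →L[ℝ] Matrix m m ℝ :=
  (selfAdjoint.submodule ℝ (Matrix m m ℝ)).subtypeL ∘L selfAdjointPartL ℝ (Matrix m m ℝ)

theorem isSelfAdjoint_symPart (Z : Matrix m m ℝ) : IsSelfAdjoint (symPart Z) :=
  (selfAdjointPart ℝ Z).2

theorem symPart_of_isSelfAdjoint {S : Matrix m m ℝ} (hS : IsSelfAdjoint S) : symPart S = S :=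
  hS.coe_selfAdjointPart_apply ℝ

theorem sub_symPart_mem_skewAdjoint (Z : Matrix m m ℝ) :
    Z - symPart Z ∈ skewAdjoint (Matrix m m ℝ) := by
  have hskew : Z - symPart Z = skewAdjointPart ℝ Z :=
    sub_eq_of_eq_add' (StarModule.selfAdjointPart_add_skewAdjointPart ℝ Z).symm
  exact hskew ▸ (skewAdjointPart ℝ Z).2

end SymmetricPart

section FrobeniusProjection

open scoped ComplexOrder MatrixOrder RealInnerProductSpace

variable {m : Type*} [Fintype m]

/-- The inner product `⟪A, B⟫ = tr (Aᵀ B)`, whose norm is the Frobenius norm. -/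
@[reducible]
def frobeniusInnerProductSpace : InnerProductSpace ℝ (Matrix m m ℝ) where
  inner A B := (Aᵀ * B).trace
  norm_sq_eq_re_inner A := by
    rw [Matrix.frobenius_norm_def, ← Real.sqrt_eq_rpow, Real.sq_sqrt (by positivity),
      Finset.sum_comm]
    simp [Matrix.trace, Matrix.mul_apply, sq]
  conj_inner_symm A B := by
    rw [conj_trivial, ← Matrix.trace_transpose, Matrix.transpose_mul, Matrix.transpose_transpose]
  add_left A B D := by rw [Matrix.transpose_add, add_mul, Matrix.trace_add]
  smul_left A B r := by simp

attribute [local instance] frobeniusInnerProductSpace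

theorem frobenius_inner_eq_trace (A B : Matrix m m ℝ) : ⟪A, B⟫ = (Aᵀ * B).trace := rfl

theorem trace_mul_nonneg_of_posSemidef {𝕜 : Type*} [RCLike 𝕜] {A B : Matrix m m 𝕜}
    (hA : A.PosSemidef) (hB : B.PosSemidef) : 0 ≤ (A * B).trace := by
  obtain ⟨k, v, rfl⟩ := Matrix.posSemidef_iff_eq_sum_vecMulVec.1 hB
  rw [Finset.mul_sum, Matrix.trace_sum]
  refine Finset.sum_nonneg fun i _ => ?_
  rw [Matrix.mul_vecMulVec, Matrix.trace_vecMulVec, dotProduct_comm]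
  exact hA.dotProduct_mulVec_nonneg _

theorem frobenius_inner_eq_zero_of_mem_skewAdjoint {A B : Matrix m m ℝ}
    (hA : A ∈ skewAdjoint (Matrix m m ℝ)) (hB : IsSelfAdjoint B) : ⟪A, B⟫ = 0 := by
  have hAt : Aᵀ = -A := hA
  have hBt : Bᵀ = B := hB
  have hneg : ⟪A, B⟫ = -⟪A, B⟫ :=
    calc ⟪A, B⟫ = (Bᵀ * A).trace := (real_inner_comm A B).symm
      _ = (A * B).trace := by rw [hBt, Matrix.trace_mul_comm]
      _ = -⟪A, B⟫ := by rw [frobenius_inner_eq_trace, hAt, neg_mul, Matrix.trace_neg, neg_neg]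
  exact self_eq_neg.1 hneg

variable [DecidableEq m]

/-- The positive part of the symmetric part of a real square matrix. On `Fin n`-indexed matrices it
is the projection onto the semidefinite cone, see `projPSD_eq_psdPart`. -/
def psdPart (Z : Matrix m m ℝ) : Matrix m m ℝ := (symPart Z)⁺

theorem posSemidef_psdPart (Z : Matrix m m ℝ) : (psdPart Z).PosSemidef :=
  Matrix.nonneg_iff_posSemidef.1 (CFC.posPart_nonneg _)

theorem inner_sub_psdPart_nonneg (Z : Matrix m m ℝ) {Y : Matrix m m ℝ} (hY : Y.PosSemidef) :
    0 ≤ ⟪Z - psdPart Z, psdPart Z - Y⟫ := by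
  have hS := isSelfAdjoint_symPart Z
  have hneg := Matrix.nonneg_iff_posSemidef.1 (CFC.negPart_nonneg (symPart Z))
  have hnegt : ((symPart Z)⁻)ᵀ = (symPart Z)⁻ := hneg.isHermitian
  have hskew : ⟪Z - symPart Z, psdPart Z - Y⟫ = 0 :=
    frobenius_inner_eq_zero_of_mem_skewAdjoint (sub_symPart_mem_skewAdjoint Z)
      ((posSemidef_psdPart Z).isHermitian.sub hY.isHermitian)
  calc 0 ≤ ((symPart Z)⁻ * Y).trace := trace_mul_nonneg_of_posSemidef hneg hY
    _ = -⟪(symPart Z)⁻, psdPart Z - Y⟫ := by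
      rw [frobenius_inner_eq_trace, hnegt, psdPart, mul_sub, CFC.negPart_mul_posPart, zero_sub,
        Matrix.trace_neg, neg_neg]
    _ = ⟪(Z - symPart Z) - (symPart Z)⁻, psdPart Z - Y⟫ := by
      rw [inner_sub_left, hskew, zero_sub]
    _ = ⟪Z - psdPart Z, psdPart Z - Y⟫ := by
      rw [sub_sub, ← sub_eq_iff_eq_add.1 (CFC.posPart_sub_negPart (symPart Z)), psdPart]

theorem projPSD_eq_psdPart {n : ℕ} : projPSD (n := n) = psdPart := by
  funext Z
  obtain ⟨hmem, hnearest⟩ := (exists_nearest_psdCone Z).choose_spec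
  exact eq_of_norm_sub_le_of_inner_nonneg (hnearest _ (posSemidef_psdPart Z))
    (inner_sub_psdPart_nonneg Z hmem)

theorem lipschitzWith_psdPart : LipschitzWith 1 (psdPart (m := m)) := by
  refine LipschitzWith.of_dist_le_mul fun Z W => ?_
  rw [NNReal.coe_one, one_mul, dist_eq_norm, dist_eq_norm]
  exact norm_sub_le_of_inner_nonneg (inner_sub_psdPart_nonneg Z (posSemidef_psdPart W))
    (inner_sub_psdPart_nonneg W (posSemidef_psdPart Z))

theorem positivelyHomogeneous_psdPart : PositivelyHomogeneous (psdPart (m := m)) := fun t ht Z => by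
  rw [psdPart, map_smul, CFC.posPart_smul_of_nonneg ht, psdPart]

end FrobeniusProjection

section SmoothAbs

open scoped ComplexOrder MatrixOrder

variable {m 𝕜 E : Type*} [Fintype m] [RCLike 𝕜]
  [NormedAddCommGroup E] [NormedSpace ℝ E] {k : WithTop ℕ∞}

theorem eq_zero_of_posDef_of_mul_add_mul_eq_zero {A H : Matrix m m 𝕜} (hA : A.PosDef)
    (h : A * H + H * A = 0) : H = 0 := by
  classical
  have h₁ : (Hᴴ * A * H).PosSemidef := hA.posSemidef.conjTranspose_mul_mul_same H
  have h₂ : (H * A * Hᴴ).PosSemidef := hA.posSemidef.mul_mul_conjTranspose_same H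
  have htrace : (Hᴴ * A * H).trace + (H * A * Hᴴ).trace = 0 := by
    rw [Matrix.trace_mul_comm (H * A), mul_assoc Hᴴ A H, ← Matrix.trace_add, ← mul_add, h, mul_zero,
      Matrix.trace_zero]
  have hzero : Hᴴ * A * H = 0 := h₁.trace_eq_zero_iff.1
    ((add_eq_zero_iff_of_nonneg h₁.trace_nonneg h₂.trace_nonneg).1 htrace).1
  refine Matrix.ext_of_mulVec_single fun i => ?_
  rw [Matrix.zero_mulVec]
  by_contra hv
  have hpos := hA.dotProduct_mulVec_pos hv
  rw [Matrix.star_mulVec, ← Matrix.dotProduct_mulVec, Matrix.mulVec_mulVec, Matrix.mulVec_mulVec,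
    hzero, Matrix.zero_mulVec, dotProduct_zero] at hpos
  exact hpos.false

/-- The derivative `H ↦ A * H + H * A` of the squaring map at `A` is invertible. -/
theorem exists_contDiffAt_leftInverse_mul_self {A : Matrix m m 𝕜} (hA : A.PosDef) (hk : k ≠ 0) :
    ∃ g : Matrix m m 𝕜 → Matrix m m 𝕜,
      ContDiffAt 𝕜 k g (A * A) ∧ ∀ᶠ X in 𝓝 A, g (X * X) = X := by
  classical
  let D : Matrix m m 𝕜 →ₗ[𝕜] Matrix m m 𝕜 := LinearMap.mulLeft 𝕜 A + LinearMap.mulRight 𝕜 A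
  have hD : Function.Injective D := (injective_iff_map_eq_zero D).2 fun _ =>
    eq_zero_of_posDef_of_mul_add_mul_eq_zero hA
  let e := (LinearEquiv.ofInjectiveEndo D hD).toContinuousLinearEquiv
  have hsq : ContDiffAt 𝕜 k (fun X : Matrix m m 𝕜 => X * X) A := contDiffAt_id.mul contDiffAt_id
  have hderiv : HasFDerivAt (fun X : Matrix m m 𝕜 => X * X)
      (e : Matrix m m 𝕜 →L[𝕜] Matrix m m 𝕜) A :=
    ((hasFDerivAt_id A).mul' (hasFDerivAt_id A)).congr_fderiv (ContinuousLinearMap.ext fun _ => rfl)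
  exact ⟨_, hsq.to_localInverse hderiv hk,
    (hsq.hasStrictFDerivAt' hderiv hk).eventually_left_inverse⟩

variable [DecidableEq m]

theorem cfcAbs_eq_two_nsmul_psdPart_sub {S : Matrix m m ℝ} (hS : IsSelfAdjoint S) :
    CFC.abs S = 2 • psdPart S - S := by
  rw [psdPart, symPart_of_isSelfAdjoint hS, ← CFC.abs_add_self S, add_sub_cancel_right]

theorem posDef_cfcAbs {S : Matrix m m 𝕜} (hS : IsUnit S) : (CFC.abs S).PosDef := by
  refine (Matrix.nonneg_iff_posSemidef.1 (CFC.abs_nonneg S)).posDef_iff_isUnit.2 ?_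
  refine isUnit_of_mul_isUnit_left (y := CFC.abs S) ?_
  rw [CFC.abs_mul_abs]
  exact hS.star.mul hS

/-- `|S|` is recovered from `|S|² = S²` by the smooth left inverse of the squaring map, once `|S|`
is known to depend continuously on `S`. -/
theorem contDiffAt_cfcAbs {S : E → Matrix m m ℝ} {w : E} (hS : ContDiffAt ℝ k S w) (hk : k ≠ 0)
    (hself : ∀ y, IsSelfAdjoint (S y)) (hunit : IsUnit (S w)) :
    ContDiffAt ℝ k (fun y => CFC.abs (S y)) w := by
  obtain ⟨g, hg, hleft⟩ := exists_contDiffAt_leftInverse_mul_self (posDef_cfcAbs hunit) hk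
  have hsq (y : E) : CFC.abs (S y) * CFC.abs (S y) = S y * S y := by
    rw [CFC.abs_mul_abs, (hself y).star_eq]
  have hcont : ContinuousAt (fun y => CFC.abs (S y)) w := by
    simp only [cfcAbs_eq_two_nsmul_psdPart_sub (hself _)]
    exact ((lipschitzWith_psdPart.continuous.continuousAt.comp hS.continuousAt).const_smul 2).sub
      hS.continuousAt
  rw [hsq] at hg
  refine (ContDiffAt.comp w hg (hS.mul hS)).congr_of_eventuallyEq ?_
  filter_upwards [hcont.eventually hleft] with y hy
  rw [Function.comp_apply, ← hsq, hy]

end SmoothAbs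

section Decomposition

open scoped MatrixOrder

variable {m : Type*} [Fintype m] [DecidableEq m] {k : WithTop ℕ∞}

theorem cfc_abs_sub_const_eq_cfcAbs {S : Matrix m m ℝ} (hS : IsSelfAdjoint S) (r : ℝ) :
    cfc (fun x => |x - r|) S = CFC.abs (S - algebraMap ℝ _ r) := by
  have hsub : S - algebraMap ℝ _ r = cfc (fun x => x - r) S := by
    rw [cfc_sub _ _ S, cfc_id' ℝ S, cfc_const r S]
  rw [hsub, CFC.abs_eq_cfc_norm _ (cfc_predicate _ S), ← cfc_comp' _ _ S]
  rfl

theorem contDiffAt_cfc_abs_sub_const_symPart {Z : Matrix m m ℝ} {r : ℝ} (hk : k ≠ 0)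
    (hr : r ∉ spectrum ℝ (symPart Z)) :
    ContDiffAt ℝ k (fun Y => cfc (fun x => |x - r|) (symPart Y)) Z := by
  simp only [cfc_abs_sub_const_eq_cfcAbs (isSelfAdjoint_symPart _)]
  have hsymm : ContDiffAt ℝ k (fun Y : Matrix m m ℝ => symPart Y) Z :=
    (symPart (m := m)).contDiff.contDiffAt
  have hshift : ContDiffAt ℝ k (fun Y => symPart Y - algebraMap ℝ (Matrix m m ℝ) r) Z :=
    hsymm.sub contDiffAt_const
  refine contDiffAt_cfcAbs hshift hk (fun Y => ?_) ?_
  · exact (isSelfAdjoint_symPart Y).sub (.algebraMap _ (.all r))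
  · exact IsUnit.sub_iff.1 (spectrum.notMem_iff.1 hr)

/-- The function `|x| / 2` modified between `0` and `c`, so that its corners lie at `c / 2` and `c`
instead of `0`. -/
def kink (c x : ℝ) : ℝ := |x - c / 2| - |x - c| / 2

@[fun_prop]
theorem continuous_kink (c : ℝ) : Continuous (kink c) := by
  unfold kink
  fun_prop

theorem kink_neg_eq_kink {c x : ℝ} (h : x = 0 ∨ |c| ≤ |x|) : kink (-c) x = kink c x := by
  unfold kink
  grind

theorem posPart_eq_add_kink {c : ℝ} (hc : 0 ≤ c) (x : ℝ) :
    x⁺ = x / 2 + kink c x + (kink (-c) x - kink c x)⁺ := by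
  unfold kink
  simp only [posPart_def]
  grind

theorem contDiffAt_cfc_kink_symPart {Z : Matrix m m ℝ} {c : ℝ} (hk : k ≠ 0)
    (hhalf : c / 2 ∉ spectrum ℝ (symPart Z)) (hc : c ∉ spectrum ℝ (symPart Z)) :
    ContDiffAt ℝ k (fun Y => cfc (kink c) (symPart Y)) Z := by
  have hsplit (Y : Matrix m m ℝ) : cfc (kink c) (symPart Y) =
      cfc (fun x => |x - c / 2|) (symPart Y) -
        (1 / 2 : ℝ) • cfc (fun x => |x - c|) (symPart Y) := by
    rw [← cfc_smul (1 / 2 : ℝ) _ (symPart Y), ← cfc_sub _ _ (symPart Y)]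
    refine cfc_congr fun x _ => ?_
    rw [kink, smul_eq_mul, one_div_mul_eq_div]
  simp only [hsplit]
  exact (contDiffAt_cfc_abs_sub_const_symPart hk hhalf).sub
    ((contDiffAt_cfc_abs_sub_const_symPart hk hc).const_smul _)

theorem psdPart_cfc {S : Matrix m m ℝ} (hS : IsSelfAdjoint S) {f : ℝ → ℝ} (hf : Continuous f) :
    psdPart (cfc f S) = cfc (fun x => (f x)⁺) S := by
  rw [psdPart, symPart_of_isSelfAdjoint (cfc_predicate f S), CFC.posPart_def, cfcₙ_eq_cfc,
    ← cfc_comp' _ f S]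

theorem psdPart_eq_add_psdPart {c : ℝ} (hc : 0 ≤ c) (Y : Matrix m m ℝ) :
    psdPart Y = (1 / 2 : ℝ) • symPart Y + cfc (kink c) (symPart Y) +
      psdPart (cfc (kink (-c)) (symPart Y) - cfc (kink c) (symPart Y)) := by
  have hS := isSelfAdjoint_symPart Y
  calc psdPart Y = cfc (fun x => x⁺) (symPart Y) := by
        rw [← psdPart_cfc hS continuous_id', cfc_id' ℝ (symPart Y), psdPart, psdPart,
          symPart_of_isSelfAdjoint hS]
    _ = cfc (fun x => (1 / 2 : ℝ) • x + kink c x + (kink (-c) x - kink c x)⁺) (symPart Y) :=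
        cfc_congr fun x _ => by rw [smul_eq_mul, one_div_mul_eq_div, posPart_eq_add_kink hc]
    _ = (1 / 2 : ℝ) • symPart Y + cfc (kink c) (symPart Y) +
          cfc (fun x => (kink (-c) x - kink c x)⁺) (symPart Y) := by
        rw [cfc_add (symPart Y) _ _, cfc_add (symPart Y) _ _, cfc_smul_id (1 / 2 : ℝ) (symPart Y)]
    _ = (1 / 2 : ℝ) • symPart Y + cfc (kink c) (symPart Y) +
          psdPart (cfc (kink (-c)) (symPart Y) - cfc (kink c) (symPart Y)) := by
        rw [← cfc_sub _ _ (symPart Y), psdPart_cfc hS (by fun_prop)]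

theorem exists_pos_lt_abs_of_finite {s : Set ℝ} (hs : s.Finite) :
    ∃ c > 0, ∀ x ∈ s, x ≠ 0 → c < |x| := by
  have hsmall : ∀ᶠ c in 𝓝[>] (0 : ℝ), ∀ x ∈ s, x ≠ 0 → c < |x| := by
    refine (eventually_all_finite hs).2 fun x _ => ?_
    by_cases hx : x = 0
    · exact .of_forall fun _ h => absurd hx h
    · filter_upwards [nhdsWithin_le_nhds (Iio_mem_nhds (abs_pos.2 hx))] with c hc _ using hc
  obtain ⟨c, hc, hpos⟩ := (hsmall.and self_mem_nhdsWithin).exists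
  exact ⟨c, hpos, hc⟩

theorem decomposableAt_psdPart (Z : Matrix m m ℝ) : DecomposableAt psdPart psdPart Z := by
  obtain ⟨c, hc, hgap⟩ := exists_pos_lt_abs_of_finite (symPart Z).finite_real_spectrum
  have hmem {r : ℝ} (hr : r ≠ 0) (hrc : |r| ≤ c) : r ∉ spectrum ℝ (symPart Z) := fun h =>
    (hgap r h hr).not_ge hrc
  have hkink {s : ℝ} (hs : |s| = c) : ContDiffAt ℝ 2 (fun Y => cfc (kink s) (symPart Y)) Z := by
    have hs₀ : s ≠ 0 := abs_pos.1 (hs ▸ hc)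
    refine contDiffAt_cfc_kink_symPart two_ne_zero ?_ (hmem hs₀ hs.le)
    refine hmem (div_ne_zero hs₀ two_ne_zero) ?_
    rw [abs_div, hs, abs_two]
    exact half_le_self hc.le
  refine ⟨_, _, ((symPart.contDiff.contDiffAt.const_smul _).add (hkink (abs_of_pos hc))),
    (hkink ((abs_neg c).trans (abs_of_pos hc))).sub (hkink (abs_of_pos hc)), ?_,
    .of_forall (psdPart_eq_add_psdPart hc.le)⟩
  · rw [sub_eq_zero]
    refine cfc_congr fun x hx => kink_neg_eq_kink ?_
    rw [abs_of_pos hc, or_iff_not_imp_left]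
    exact fun hx₀ => (hgap x hx hx₀).le

end Decomposition

section Residual

open Matrix

variable {n : ℕ} {m E F : Type*} [Fintype m] [DecidableEq m]
  [NormedAddCommGroup E] [NormedSpace ℝ E] [NormedAddCommGroup F] [NormedSpace ℝ F]

theorem stronglySemismooth_affine_add_psdPart (L : E →L[ℝ] F) (c : F) (T : Matrix m m ℝ →L[ℝ] F)
    (A : E →L[ℝ] Matrix m m ℝ) (b : Matrix m m ℝ) :
    StronglySemismooth fun w => L w + c + T (psdPart (A w + b)) := by
  have hTlip := T.lipschitz.comp (lipschitzWith_psdPart (m := m))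
  have hThom : PositivelyHomogeneous fun X : Matrix m m ℝ => T (psdPart X) := fun t ht X => by
    simp only [positivelyHomogeneous_psdPart ht X, map_smul]
  refine ⟨⟨_, (L.lipschitz.add (.const c)).add (hTlip.comp (A.lipschitz.add (.const b)))⟩,
    fun w => ?_⟩
  have hdec : DecomposableAt psdPart (fun u => psdPart (A u + b)) w :=
    (decomposableAt_psdPart _).comp (A.contDiff.contDiffAt.add contDiffAt_const)
  exact ((hdec.clm_comp T).contDiffAt_add
    (L.contDiff.contDiffAt.add contDiffAt_const)).stronglySemismoothAt hThom hTlip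

theorem stronglySemismooth_affine_add_psdPart_of_finiteDimensional [FiniteDimensional ℝ E]
    (L : E →ₗ[ℝ] F) (c : F) (T : Matrix m m ℝ →ₗ[ℝ] F) (A : E →ₗ[ℝ] Matrix m m ℝ)
    (b : Matrix m m ℝ) : StronglySemismooth fun w => L w + c + T (psdPart (A w + b)) :=
  stronglySemismooth_affine_add_psdPart L.toContinuousLinearMap c T.toContinuousLinearMap
    A.toContinuousLinearMap b

theorem isLinearMap_opPhi (Φ : Fin n → Fin n → ℝ) : IsLinearMap ℝ (opPhi Φ) where
  map_add X Y := funext fun i => by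
    simp only [opPhi, transpose_add, add_mul, trace_add, Pi.add_apply]
  map_smul t X := funext fun i => by
    simp only [opPhi, transpose_smul, smul_mul, trace_smul, Pi.smul_apply]

theorem isLinearMap_opPhiAdj (Φ : Fin n → Fin n → ℝ) : IsLinearMap ℝ (opPhiAdj Φ) where
  map_add γ δ := by simp only [opPhiAdj, Pi.add_apply, add_smul, Finset.sum_add_distrib]
  map_smul t γ := by simp only [opPhiAdj, Pi.smul_apply, smul_assoc, Finset.smul_sum]

/-- The linear part of the residual map outside the projection. -/
noncomputable def residualLinear (Q : Matrix (Fin n) (Fin n) ℝ) (Φ : Fin n → Fin n → ℝ)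
    (lam₂ : ℝ) : PairSpace n →ₗ[ℝ] PairSpace n where
  toFun w := WithLp.toLp 1
    (WithLp.toLp 2 ((1 / (2 * lam₂)) • (Q *ᵥ w.fst.ofLp) - opPhi Φ w.snd), w.snd)
  map_add' v w := by
    rw [WithLp.add_fst, WithLp.add_snd, WithLp.ofLp_add, mulVec_add, smul_add,
      (isLinearMap_opPhi Φ).map_add, add_sub_add_comm]
    rfl
  map_smul' t w := by
    rw [WithLp.smul_fst, WithLp.smul_snd, WithLp.ofLp_smul, mulVec_smul, smul_comm,
      (isLinearMap_opPhi Φ).map_smul, ← smul_sub]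
    rfl

/-- The linear part of the matrix projected by the residual map. -/
noncomputable def residualArgLinear (Φ : Fin n → Fin n → ℝ) :
    PairSpace n →ₗ[ℝ] Matrix (Fin n) (Fin n) ℝ where
  toFun w := w.snd - opPhiAdj Φ w.fst.ofLp
  map_add' v w := by
    rw [WithLp.add_fst, WithLp.add_snd, WithLp.ofLp_add, (isLinearMap_opPhiAdj Φ).map_add,
      add_sub_add_comm]
  map_smul' t w := by
    rw [WithLp.smul_fst, WithLp.smul_snd, WithLp.ofLp_smul, (isLinearMap_opPhiAdj Φ).map_smul,
      ← smul_sub, RingHom.id_apply]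

/-- The map `X ↦ (0, -X)`, through which the projection enters the residual map. -/
noncomputable def negInclusion (n : ℕ) : Matrix (Fin n) (Fin n) ℝ →ₗ[ℝ] PairSpace n where
  toFun X := WithLp.toLp 1 (0, -X)
  map_add' X Y := by rw [neg_add, ← WithLp.toLp_add, Prod.mk_add_mk, add_zero]
  map_smul' t X := by rw [RingHom.id_apply, ← smul_neg, ← WithLp.toLp_smul, Prod.smul_mk, smul_zero]

theorem residualMap_eq (Q : Matrix (Fin n) (Fin n) ℝ) (z : Fin n → ℝ) (Φ : Fin n → Fin n → ℝ)
    (lam₁ lam₂ : ℝ) (w : PairSpace n) :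
    residualMap Q z Φ lam₁ lam₂ w =
      residualLinear Q Φ lam₂ w + WithLp.toLp 1 (-WithLp.toLp 2 ((1 / (2 * lam₂)) • z), 0) +
        negInclusion n (psdPart (residualArgLinear Φ w + -(lam₁ • 1))) := by
  have harg : residualArgLinear Φ w + -(lam₁ • 1) =
      w.snd - (opPhiAdj Φ w.fst.ofLp + lam₁ • (1 : Matrix (Fin n) (Fin n) ℝ)) :=
    (sub_eq_add_neg _ _).symm.trans (sub_sub _ _ _)
  rw [harg, residualMap, projPSD_eq_psdPart, sub_right_comm]
  refine WithLp.ofLp_injective 1 (Prod.ext ?_ ?_)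
  · change _ = _ + -_ + (0 : EuclideanSpace ℝ (Fin n))
    rw [add_zero, ← sub_eq_add_neg]
    rfl
  · change w.snd - _ = w.snd + 0 + -_
    rw [add_zero, sub_eq_add_neg]

end Residual

theorem proposition2 {n : ℕ} (Q : Matrix (Fin n) (Fin n) ℝ) (z : Fin n → ℝ)
    (Φ : Fin n → Fin n → ℝ) (lam₁ lam₂ : ℝ) (hlam₁ : 0 < lam₁) (hlam₂ : 0 < lam₂) :
    StronglySemismooth (residualMap Q z Φ lam₁ lam₂) := by
  rw [funext (residualMap_eq Q z Φ lam₁ lam₂)]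
  exact stronglySemismooth_affine_add_psdPart_of_finiteDimensional _ _ _ _ _
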